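/- Let $\mathcal X,\mathcal Y$ be real Hilbert spaces and let $\Gamma_0(\mathcal Y)$ denote the set of proper lower semicontinuous convex functions $\mathcal Y\to\mathbb R\cup\{\infty\}$. Let $f:\mathcal X\to\mathbb R$ be convex and differentiable with $\beta$-Lipschitz gradient, where $\beta>0$, let $h\in\Gamma_0(\mathcal Y)$ with convex conjugate $h^*$, let $L:\mathcal X\to\mathcal Y$ be a bounded linear operator with adjoint $L^*$, and let $\gamma_1,\gamma_2>0$. Let $J:\mathcal X\to\mathcal X$ be firmly nonexpansive (i.e. $2J-\mathrm{Id}$ is nonexpansive) and defined on all of $\mathcal X$. Then there exists a maximally monotone operator $A_J:\mathcal X\to 2^{\mathcal X}$ such that $J=(A_J+\mathrm{Id})^{-1}$. Moreover, for every such $A_J$, assume that the solution set of the problem: find $(\hat x,\hat y)\in\mathcal X\times\mathcal Y$ such that $$0\in\gamma_1^{-1}A_J(\hat x)+L^*\hat y+\nabla f(\hat x),\qquad 0\in -L\hat x+\partial h^*(\hat y) \tag{1}$$ is nonempty, and that (i) $\frac1{\gamma_1}-\gamma_2\|L\|^2>\frac\beta2$, (ii) $\rho_n\in(0,\delta)$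 for all $n\in\mathbb N$, (iii) $\sum_{n\in\mathbb N}\rho_n(\delta-\rho_n)=\infty$, where $\delta:=2-\frac\beta2\left(\frac1{\gamma_1}-\gamma_2\|L\|^2\right)^{-1}$. Then for every starting point $(x_0,y_0)\in\mathcal X\times\mathcal Y$, the sequence $(x_n,y_n)_{n\in\mathbb N}$ generated by $$\begin{aligned} \tilde x_{n+1}&=J\bigl(x_n-\gamma_1(\nabla f(x_n)+L^*y_n)\bigr),\\ \tilde y_{n+1}&=\mathrm{prox}_{\gamma_2h^*}\bigl(y_n+\gamma_2L(2\tilde x_{n+1}-x_n)\bigr),\\ x_{n+1}&=\rho_n\tilde x_{n+1}+(1-\rho_n)x_n,\\ y_{n+1}&=\rho_n\tilde y_{n+1}+(1-\rho_n)y_n, \end{aligned}$$ where $\mathrm{prox}_{\gamma F}(u)=\operatorname{argmin}_{v}\,F(v)+\frac1{2\gamma}\|v-u\|^2$, converges weakly in $\mathcal X\times\mathcal Y$ to a solution of (1). -/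

import Mathlib

open Filter Topology
open scoped Pointwise

noncomputable section

namespace PnPPDS

section Operators

variable {H : Type*} [NormedAddCommGroup H] [InnerProductSpace ℝ H]

/-- `T` is nonexpansive on the whole space. -/
def IsNonexpansive (T : H → H) : Prop :=
  ∀ x₁ x₂ : H, ‖T x₁ - T x₂‖ ≤ ‖x₁ - x₂‖

/-- `T` is firmly nonexpansive: `2 T - Id` is nonexpansive. -/
def IsFirmlyNonexpansive (T : H → H) : Prop :=
  IsNonexpansive fun x => (2 : ℝ) • T x - x

/-- The graph of a set-valued operator. -/
def graph (A : H → Set H) : Set (H × H) :=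
  {p | p.2 ∈ A p.1}

/-- Monotone set-valued operators. -/
def IsMonotoneOp (A : H → Set H) : Prop :=
  ∀ p ∈ graph A, ∀ q ∈ graph A, 0 ≤ inner ℝ (p.1 - q.1) (p.2 - q.2)

/-- Maximally monotone set-valued operators: monotone, and no monotone operator has a graph that
properly contains the graph of `A`. -/
def IsMaximallyMonotone (A : H → Set H) : Prop :=
  IsMonotoneOp A ∧ ¬ ∃ B : H → Set H, IsMonotoneOp B ∧ graph A ⊂ graph B

/-- The inverse of a set-valued operator. -/
def inverseOp (A : H → Set H) : H → Set H :=
  fun u => {x | u ∈ A x}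

/-- `J = (A + Id)⁻¹`, as an equality of set-valued operators (the point-valued map `J` is read as
`u ↦ {J u}`). -/
def IsResolventOf (J : H → H) (A : H → Set H) : Prop :=
  (fun u => ({J u} : Set H)) = inverseOp fun x => A x + {x}

end Operators

section ConvexFunctions

variable {H : Type*} [NormedAddCommGroup H] [InnerProductSpace ℝ H]

/-- The class `Γ₀(H)` of proper lower semicontinuous convex functions `H → ℝ ∪ {∞}`. -/
structure IsGammaZero (F : H → EReal) : Prop where
  ne_bot : ∀ x, F x ≠ ⊥
  exists_ne_top : ∃ x, F x ≠ ⊤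
  lowerSemicontinuous : LowerSemicontinuous F
  convex : ∀ x y : H, ∀ a b : ℝ, 0 < a → 0 < b → a + b = 1 →
    F (a • x + b • y) ≤ (a : EReal) * F x + (b : EReal) * F y

/-- The convex conjugate `F* u = sup_y (⟨u, y⟩ - F y)`. -/
def conjugate (F : H → EReal) (u : H) : EReal :=
  ⨆ y : H, ((inner ℝ u y : ℝ) : EReal) - F y

/-- The subdifferential of an extended-real-valued function. -/
def subdifferential (F : H → EReal) (x : H) : Set H :=
  {u | ∀ y : H, ((inner ℝ (y - x) u : ℝ) : EReal) + F x ≤ F y}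

/-- The proximity operator: `prox γ F x` is the minimizer of `y ↦ F y + ‖y - x‖² / (2 γ)`
(which exists and is unique if `F ∈ Γ₀(H)` and `γ > 0`). -/
def prox (γ : ℝ) (F : H → EReal) (x : H) : H :=
  Classical.epsilon fun p =>
    IsMinOn (fun y : H => F y + ((1 / (2 * γ) * ‖y - x‖ ^ 2 : ℝ) : EReal)) Set.univ p

end ConvexFunctions

section Algorithm

variable {X Y : Type*}
  [NormedAddCommGroup X] [InnerProductSpace ℝ X] [CompleteSpace X]
  [NormedAddCommGroup Y] [InnerProductSpace ℝ Y] [CompleteSpace Y]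

/-- The pairs `(x, y)` with `0 ∈ γ₁⁻¹ A x + L* y + ∇f x` and `0 ∈ - L x + ∂h*(y)`. -/
def solutionSet (A : X → Set X) (f : X → ℝ) (h : Y → EReal) (L : X →L[ℝ] Y) (γ₁ : ℝ) :
    Set (X × Y) :=
  {z | (0 : X) ∈ γ₁⁻¹ • A z.1 + {ContinuousLinearMap.adjoint L z.2} + {gradient f z.1} ∧
       (0 : Y) ∈ {-(L z.1)} + subdifferential (conjugate h) z.2}

/-- `(x n, y n)` is generated by the relaxed plug-and-play primal-dual splitting iteration, with
`xt n`, `yt n` the intermediate points; the starting point is arbitrary. -/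
def IsIteration (J : X → X) (f : X → ℝ) (h : Y → EReal) (L : X →L[ℝ] Y) (γ₁ γ₂ : ℝ)
    (ρ : ℕ → ℝ) (x : ℕ → X) (y : ℕ → Y) : Prop :=
  ∃ (xt : ℕ → X) (yt : ℕ → Y), ∀ n : ℕ,
    xt (n + 1) = J (x n - γ₁ • (gradient f (x n) + ContinuousLinearMap.adjoint L (y n))) ∧
    yt (n + 1) = prox γ₂ (conjugate h) (y n + γ₂ • L ((2 : ℝ) • xt (n + 1) - x n)) ∧
    x (n + 1) = ρ n • xt (n + 1) + (1 - ρ n) • x n ∧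
    y (n + 1) = ρ n • yt (n + 1) + (1 - ρ n) • y n

/-- Weak convergence of a sequence in a real Hilbert space. -/
def WeaklyConverges {H : Type*} [NormedAddCommGroup H] [InnerProductSpace ℝ H]
    (s : ℕ → H) (l : H) : Prop :=
  Tendsto (fun n => toWeakSpace ℝ H (s n)) atTop (𝓝 (toWeakSpace ℝ H l))

end Algorithm

end PnPPDS

end

/-! Write `T` for one unrelaxed step on the Hilbert product and `R = Id - T`, so that the algorithm
reads `z ↦ z - ρ n • R z`. Since `J` and the proximity operator are resolvents, the zeros of `R` are
exactly the solutions of the inclusion (`primalDualResidual_eq_zero_iff`).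

The geometry that suits `T` is that of `P (x, y) = (x / γ₁ - L* y, y / γ₂ - L x)`, which is coercive
once `κ = 1 / γ₁ - γ₂ ‖L‖²` is positive. Adding the monotonicity inequalities of `J` and `∂h*`, the
extrapolation `2 x̃ - x` makes the cross terms assemble into `P`. Only the gradient term remains; by
Baillon–Haddad (`norm_sq_gradient_sub_le`) it costs at most `β / 2` times a squared primal norm,
which `P` controls up to `κ⁻¹`. Hence `R` is cocoercive in the metric `P` with exactly the constant
`δ` (`primalDualResidual_cocoercive`).

Weak convergence is then a Krasnosel'skiĭ–Mann argument (`exists_weak_limit_of_cocoercive`): Fejér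
monotonicity and the divergent series force `R (z n) → 0`, cocoercivity makes every weak cluster
point a zero, and Opial's argument leaves only one. The operator `A_J` is `J⁻¹ - Id`, maximal
because `J` is defined everywhere. -/

namespace PnPPDS

/-! ### Convex conjugates, subdifferentials and the proximity operator -/

section ConvexAnalysis

variable {H : Type*} [NormedAddCommGroup H] [InnerProductSpace ℝ H]

/-- A function in `Γ₀` takes real values wherever it is not `⊤`. -/
theorem IsGammaZero.coe_toReal {F : H → EReal} (hF : IsGammaZero F) {x : H} (hx : F x ≠ ⊤) :
    ((F x).toReal : EReal) = F x :=
  EReal.coe_toReal hx (hF.ne_bot x)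

/-- Convexity of a function in `Γ₀` for real upper bounds of its values. -/
theorem IsGammaZero.convex_le {F : H → EReal} (hF : IsGammaZero F) {x y : H} {r s : ℝ}
    (hx : F x ≤ r) (hy : F y ≤ s) {a b : ℝ} (ha : 0 < a) (hb : 0 < b) (hab : a + b = 1) :
    F (a • x + b • y) ≤ ((a * r + b * s : ℝ) : EReal) := by
  refine (hF.convex x y a b ha hb hab).trans ?_
  rw [EReal.coe_add, EReal.coe_mul, EReal.coe_mul]
  have ha' : (0 : EReal) ≤ (a : EReal) := by exact_mod_cast ha.le
  have hb' : (0 : EReal) ≤ (b : EReal) := by exact_mod_cast hb.le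
  exact add_le_add (mul_le_mul_of_nonneg_left hx ha') (mul_le_mul_of_nonneg_left hy hb')

/-- The real epigraph of a function in `Γ₀` is convex. -/
theorem IsGammaZero.convex_epigraph {F : H → EReal} (hF : IsGammaZero F) :
    Convex ℝ {p : H × ℝ | F p.1 ≤ (p.2 : EReal)} := by
  rw [convex_iff_forall_pos]
  intro p hp q hq a b ha hb hab
  exact hF.convex_le hp hq ha hb hab

/-- The real epigraph of a function in `Γ₀` is closed. -/
theorem IsGammaZero.isClosed_epigraph {F : H → EReal} (hF : IsGammaZero F) :
    IsClosed {p : H × ℝ | F p.1 ≤ (p.2 : EReal)} :=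
  hF.lowerSemicontinuous.isClosed_epigraph.preimage
    (f := fun p : H × ℝ => (p.1, (p.2 : EReal)))
    (continuous_fst.prodMk (continuous_coe_real_ereal.comp continuous_snd))

/-- A function in `Γ₀` has a continuous affine minorant. -/
theorem IsGammaZero.exists_affine_le [CompleteSpace H] {F : H → EReal} (hF : IsGammaZero F) :
    ∃ (u : H) (c : ℝ), ∀ y, ((inner ℝ u y + c : ℝ) : EReal) ≤ F y := by
  obtain ⟨y₀, hy₀⟩ := hF.exists_ne_top
  set r₀ := (F y₀).toReal with hr₀
  have hFr : F y₀ = r₀ := (hF.coe_toReal hy₀).symm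
  have hnot : (y₀, r₀ - 1) ∉ {p : H × ℝ | F p.1 ≤ (p.2 : EReal)} := by
    simp only [Set.mem_ofPred_eq, hFr, EReal.coe_le_coe_iff]
    linarith
  obtain ⟨φ, s, hs, hφ⟩ :=
    geometric_hahn_banach_point_closed hF.convex_epigraph hF.isClosed_epigraph hnot
  have hsplit : ∀ (y : H) (t : ℝ), φ (y, t) = φ (y, 0) + t * φ (0, 1) := by
    intro y t
    have : ((y, t) : H × ℝ) = (y, 0) + t • (0, 1) := by simp
    rw [this, map_add, map_smul, smul_eq_mul]
  -- This point lies directly above the separated one, so the separation forces a positive vertical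
  -- coefficient: the hyperplane is the graph of an affine function.
  have h₀ := hφ (y₀, r₀) (by simp [hFr])
  rw [hsplit] at h₀ hs
  have ha : 0 < φ (0, 1) := by nlinarith
  set a := φ (0, 1) with hadef
  let ψ : H →L[ℝ] ℝ := φ.comp (ContinuousLinearMap.inl ℝ H ℝ)
  refine ⟨(InnerProductSpace.toDual ℝ H).symm (-(a⁻¹ • ψ)), s / a, fun y => ?_⟩
  rw [InnerProductSpace.toDual_symm_apply]
  by_cases hy : F y = ⊤
  · rw [hy]; exact le_top
  · have hFy := hF.coe_toReal hy
    have h1 := hφ (y, (F y).toReal) (by simp [hFy])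
    rw [hsplit] at h1
    rw [← hFy, EReal.coe_le_coe_iff]
    have h2 : ψ y = φ (y, 0) := rfl
    simp only [neg_apply, smul_apply, smul_eq_mul, h2]
    rw [inv_mul_eq_div, ← sub_eq_neg_add, ← sub_div, div_le_iff₀ ha]
    linarith

/-- An upper bound of the conjugate is the same as an affine minorant. -/
theorem conjugate_le_iff {F : H → EReal} (hF : ∀ x, F x ≠ ⊥) {u : H} {r : ℝ} :
    conjugate F u ≤ r ↔ ∀ y, ((inner ℝ u y - r : ℝ) : EReal) ≤ F y := by
  unfold conjugate
  rw [iSup_le_iff]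
  refine forall_congr' fun y => ?_
  by_cases hy : F y = ⊤
  · simp [hy]
  · rw [← EReal.coe_toReal hy (hF y), ← EReal.coe_sub, EReal.coe_le_coe_iff,
      EReal.coe_le_coe_iff]
    constructor <;> intro h <;> linarith

/-- The conjugate of a function in `Γ₀` is in `Γ₀`. -/
theorem IsGammaZero.conjugate [CompleteSpace H] {F : H → EReal} (hF : IsGammaZero F) :
    IsGammaZero (conjugate F) where
  ne_bot u := by
    obtain ⟨y₀, hy₀⟩ := hF.exists_ne_top
    refine ne_bot_of_le_ne_bot ?_
      (le_iSup (fun y : H => ((inner ℝ u y : ℝ) : EReal) - F y) y₀)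
    rw [← hF.coe_toReal hy₀, ← EReal.coe_sub]
    exact EReal.coe_ne_bot _
  exists_ne_top := by
    obtain ⟨u, c, huc⟩ := hF.exists_affine_le
    refine ⟨u, ne_top_of_le_ne_top (EReal.coe_ne_top (-c)) ?_⟩
    rw [conjugate_le_iff hF.ne_bot]
    simpa [sub_neg_eq_add] using huc
  lowerSemicontinuous := by
    refine lowerSemicontinuous_iSup fun y => Continuous.lowerSemicontinuous ?_
    by_cases hy : F y = ⊤
    · simpa [hy] using continuous_const
    · rw [← hF.coe_toReal hy]
      simp_rw [← EReal.coe_sub]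
      exact continuous_coe_real_ereal.comp (by fun_prop)
  convex x y a b ha hb hab := by
    refine iSup_le fun z => ?_
    by_cases hz : F z = ⊤
    · simp [hz]
    · have ha' : (0 : EReal) ≤ (a : EReal) := by exact_mod_cast ha.le
      have hb' : (0 : EReal) ≤ (b : EReal) := by exact_mod_cast hb.le
      refine le_trans (le_of_eq ?_) (add_le_add
        (mul_le_mul_of_nonneg_left
          (le_iSup (fun z : H => ((inner ℝ x z : ℝ) : EReal) - F z) z) ha')
        (mul_le_mul_of_nonneg_left
          (le_iSup (fun z : H => ((inner ℝ y z : ℝ) : EReal) - F z) z) hb'))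
      rw [← hF.coe_toReal hz, ← EReal.coe_sub, ← EReal.coe_sub, ← EReal.coe_sub,
        ← EReal.coe_mul, ← EReal.coe_mul, ← EReal.coe_add, EReal.coe_eq_coe_iff,
        inner_add_left, real_inner_smul_left, real_inner_smul_left]
      linear_combination (F z).toReal * hab

/-- The value of a function in `Γ₀` at a point with a subgradient is finite. -/
theorem IsGammaZero.ne_top_of_mem_subdifferential {F : H → EReal} (hF : IsGammaZero F)
    {x u : H} (hu : u ∈ subdifferential F x) : F x ≠ ⊤ := by
  intro hx
  obtain ⟨y, hy⟩ := hF.exists_ne_top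
  have := hu y
  rw [hx, EReal.coe_add_top, top_le_iff] at this
  exact hy this

/-- The subdifferential of a function in `Γ₀` is monotone. -/
theorem IsGammaZero.isMonotoneOp_subdifferential {F : H → EReal} (hF : IsGammaZero F) :
    IsMonotoneOp (subdifferential F) := by
  rintro ⟨x, u⟩ hu ⟨y, v⟩ hv
  change u ∈ subdifferential F x at hu
  change v ∈ subdifferential F y at hv
  have h1 := hu y
  have h2 := hv x
  rw [← hF.coe_toReal (hF.ne_top_of_mem_subdifferential hu),
    ← hF.coe_toReal (hF.ne_top_of_mem_subdifferential hv), ← EReal.coe_add,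
    EReal.coe_le_coe_iff] at h1 h2
  have h3 : inner ℝ (y - x) u = -inner ℝ (x - y) u := by rw [← neg_sub, inner_neg_left]
  change 0 ≤ inner ℝ (x - y) (u - v)
  rw [inner_sub_right]
  linarith

/-- The parallelogram identity for the distances of two points to a third. -/
theorem norm_sq_midpoint_sub (x y z : H) :
    ‖((1 / 2 : ℝ) • y + (1 / 2 : ℝ) • z) - x‖ ^ 2
      = 1 / 2 * ‖y - x‖ ^ 2 + 1 / 2 * ‖z - x‖ ^ 2 - 1 / 4 * ‖y - z‖ ^ 2 := by
  have h1 : ((1 / 2 : ℝ) • y + (1 / 2 : ℝ) • z) - x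
      = (1 / 2 : ℝ) • ((y - x) + (z - x)) := by module
  have h2 : y - z = (y - x) - (z - x) := by abel
  rw [h1, h2, norm_smul, mul_pow, norm_add_sq_real, norm_sub_sq_real (y - x) (z - x)]
  norm_num
  ring

/-- The proximal objective of a function in `Γ₀` has a minimizer. -/
theorem IsGammaZero.exists_isMinOn_prox [CompleteSpace H] {F : H → EReal} (hF : IsGammaZero F)
    {γ : ℝ} (hγ : 0 < γ) (x : H) :
    ∃ p, IsMinOn (fun y : H => F y + ((1 / (2 * γ) * ‖y - x‖ ^ 2 : ℝ) : EReal)) Set.univ p := by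
  set k : ℝ := 1 / (2 * γ) with hk
  have hk0 : 0 < k := by positivity
  set G : H → ℝ := fun y => (F y).toReal + k * ‖y - x‖ ^ 2 with hG
  set S : Set ℝ := G '' {y | F y ≠ ⊤} with hS
  obtain ⟨u, c, huc⟩ := hF.exists_affine_le
  have hbdd : BddBelow S := by
    -- The minimum over `‖y - x‖` of the affine minorant's Cauchy–Schwarz bound plus the quadratic
    -- term.
    refine ⟨inner ℝ u x + c - ‖u‖ ^ 2 / (4 * k), ?_⟩
    rintro _ ⟨y, hy, rfl⟩
    have h1 := huc y
    rw [← hF.coe_toReal hy, EReal.coe_le_coe_iff] at h1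
    have h2 : inner ℝ u y = inner ℝ u x + inner ℝ u (y - x) := by
      rw [inner_sub_right]; ring
    have h3 := neg_le_of_abs_le (abs_real_inner_le_norm u (y - x))
    have h4 : 0 ≤ (‖u‖ - 2 * k * ‖y - x‖) ^ 2 / (4 * k) := by positivity
    have h5 : (‖u‖ - 2 * k * ‖y - x‖) ^ 2 / (4 * k)
        = ‖u‖ ^ 2 / (4 * k) - ‖u‖ * ‖y - x‖ + k * ‖y - x‖ ^ 2 := by
      field_simp
      ring
    simp only [hG]
    linarith
  have hne : S.Nonempty := by
    obtain ⟨y, hy⟩ := hF.exists_ne_top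
    exact ⟨_, y, hy, rfl⟩
  set m := sInf S with hm
  have hmle : ∀ y, F y ≠ ⊤ → m ≤ G y := fun y hy => csInf_le hbdd ⟨y, hy, rfl⟩
  have hex : ∀ n : ℕ, ∃ y, F y ≠ ⊤ ∧ G y < m + 1 / ((n : ℝ) + 1) := by
    intro n
    obtain ⟨_, ⟨y, hy, rfl⟩, hlt⟩ := exists_lt_of_csInf_lt hne
      (show sInf S < m + 1 / ((n : ℝ) + 1) by
        have : 0 < 1 / ((n : ℝ) + 1) := by positivity
        linarith)
    exact ⟨y, hy, hlt⟩
  choose s hs_top hs using hex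
  -- Strong convexity: the midpoint value is at least `m`, so two near-minimizers must be close.
  have hmid : ∀ n l, k / 4 * ‖s n - s l‖ ^ 2
      ≤ 1 / 2 * (1 / ((n : ℝ) + 1)) + 1 / 2 * (1 / ((l : ℝ) + 1)) := by
    intro n l
    have h1 := hF.convex_le (hF.coe_toReal (hs_top n)).ge (hF.coe_toReal (hs_top l)).ge
      (show (0 : ℝ) < 1 / 2 by norm_num) (show (0 : ℝ) < 1 / 2 by norm_num) (by norm_num)
    set q := (1 / 2 : ℝ) • s n + (1 / 2 : ℝ) • s l with hq
    have hqt : F q ≠ ⊤ := ne_top_of_le_ne_top (EReal.coe_ne_top _) h1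
    have h2 := hmle q hqt
    rw [← hF.coe_toReal hqt, EReal.coe_le_coe_iff] at h1
    have h3 := norm_sq_midpoint_sub x (s n) (s l)
    have h4 := hs n
    have h5 := hs l
    simp only [hG] at h2 h4 h5
    rw [hq, h3, ← hq] at h2
    nlinarith
  have hcauchy : CauchySeq s := by
    refine cauchySeq_of_le_tendsto_0 (fun N : ℕ => √(4 / k * (1 / ((N : ℝ) + 1)))) ?_ ?_
    · intro n l N hn hl
      rw [dist_eq_norm]
      refine Real.le_sqrt_of_sq_le ?_
      have h1 := hmid n l
      have h2 : 1 / ((n : ℝ) + 1) ≤ 1 / ((N : ℝ) + 1) := by gcongr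
      have h3 : 1 / ((l : ℝ) + 1) ≤ 1 / ((N : ℝ) + 1) := by gcongr
      rw [div_mul_eq_mul_div, le_div_iff₀ hk0]
      linarith
    · have h1 : Tendsto (fun N : ℕ => √(4 / k * (1 / ((N : ℝ) + 1)))) atTop
          (𝓝 (√(4 / k * 0))) :=
        (tendsto_one_div_add_atTop_nhds_zero_nat.const_mul _).sqrt
      simpa using h1
  obtain ⟨p, hp⟩ := cauchySeq_tendsto_of_complete hcauchy
  have hFp : F p ≤ ((m - k * ‖p - x‖ ^ 2 : ℝ) : EReal) := by
    by_contra! hlt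
    obtain ⟨r, hr1, hr2⟩ := EReal.lt_iff_exists_real_btwn.1 hlt
    have h1 : ∀ᶠ n in atTop, (r : EReal) < F (s n) :=
      hp.eventually (hF.lowerSemicontinuous p r hr2)
    have h2 : ∀ᶠ n : ℕ in atTop, r + k * ‖s n - x‖ ^ 2 ≤ m + 1 / ((n : ℝ) + 1) := by
      filter_upwards [h1] with n hn
      rw [← hF.coe_toReal (hs_top n), EReal.coe_lt_coe_iff] at hn
      have := hs n
      simp only [hG] at this
      linarith
    have h3 : Tendsto (fun n => r + k * ‖s n - x‖ ^ 2) atTop (𝓝 (r + k * ‖p - x‖ ^ 2)) :=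
      ((((hp.sub_const x).norm).pow 2).const_mul k).const_add r
    have h4 : Tendsto (fun n : ℕ => m + 1 / ((n : ℝ) + 1)) atTop (𝓝 (m + 0)) :=
      tendsto_one_div_add_atTop_nhds_zero_nat.const_add m
    have h5 := le_of_tendsto_of_tendsto h3 h4 h2
    rw [EReal.coe_lt_coe_iff] at hr1
    linarith
  refine ⟨p, fun y _ => ?_⟩
  change F p + ((k * ‖p - x‖ ^ 2 : ℝ) : EReal) ≤ F y + ((k * ‖y - x‖ ^ 2 : ℝ) : EReal)
  by_cases hy : F y = ⊤
  · rw [hy, EReal.top_add_coe]; exact le_top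
  · have hpt : F p ≠ ⊤ := ne_top_of_le_ne_top (EReal.coe_ne_top _) hFp
    have h1 := hmle y hy
    rw [← hF.coe_toReal hpt, EReal.coe_le_coe_iff] at hFp
    rw [← hF.coe_toReal hpt, ← hF.coe_toReal hy, ← EReal.coe_add, ← EReal.coe_add,
      EReal.coe_le_coe_iff]
    simp only [hG] at h1
    linarith

/-- The residual of the proximity operator is a subgradient. -/
theorem IsGammaZero.sub_prox_mem_subdifferential [CompleteSpace H] {F : H → EReal}
    (hF : IsGammaZero F) {γ : ℝ} (hγ : 0 < γ) (x : H) :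
    γ⁻¹ • (x - prox γ F x) ∈ subdifferential F (prox γ F x) := by
  have hmin : IsMinOn (fun y : H => F y + ((1 / (2 * γ) * ‖y - x‖ ^ 2 : ℝ) : EReal)) Set.univ
      (prox γ F x) := Classical.epsilon_spec (hF.exists_isMinOn_prox hγ x)
  set p := prox γ F x with hpdef
  have hp : F p ≠ ⊤ := by
    intro hp
    obtain ⟨y, hy⟩ := hF.exists_ne_top
    have h1 := hmin (Set.mem_univ y)
    simp only [Set.mem_ofPred_eq, hp, EReal.top_add_coe, top_le_iff] at h1
    rw [← hF.coe_toReal hy, ← EReal.coe_add] at h1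
    exact EReal.coe_ne_top _ h1
  intro y
  by_cases hy : F y = ⊤
  · rw [hy]; exact le_top
  rw [← hF.coe_toReal hp, ← hF.coe_toReal hy, ← EReal.coe_add, EReal.coe_le_coe_iff]
  set k : ℝ := 1 / (2 * γ) with hk
  have hkγ : γ⁻¹ = 2 * k := by rw [hk]; field_simp
  have hi : inner ℝ (y - p) (γ⁻¹ • (x - p)) = -(2 * k * inner ℝ (p - x) (y - p)) := by
    rw [hkγ, real_inner_smul_right, real_inner_comm, ← neg_sub p x, inner_neg_left]
    ring
  -- The minimizer is compared with a point of the segment towards `y`; after division by `t`, the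
  -- quadratic error is of order `t`.
  have key : ∀ t : ℝ, 0 < t → t < 1 →
      (F p).toReal ≤ (F y).toReal + 2 * k * inner ℝ (p - x) (y - p)
        + t * (k * ‖y - p‖ ^ 2) := by
    intro t ht0 ht1
    have h1 := hF.convex_le (hF.coe_toReal hp).ge (hF.coe_toReal hy).ge
      (sub_pos.2 ht1) ht0 (by ring)
    set q := (1 - t) • p + t • y with hq
    have hqt : F q ≠ ⊤ := ne_top_of_le_ne_top (EReal.coe_ne_top _) h1
    have h2 := hmin (Set.mem_univ q)
    simp only [Set.mem_ofPred_eq] at h2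
    rw [← hF.coe_toReal hp, ← hF.coe_toReal hqt, ← EReal.coe_add, ← EReal.coe_add,
      EReal.coe_le_coe_iff] at h2
    rw [← hF.coe_toReal hqt, EReal.coe_le_coe_iff] at h1
    have h3 : q - x = (p - x) + t • (y - p) := by rw [hq]; module
    rw [h3, norm_add_sq_real, norm_smul, mul_pow, real_inner_smul_right, Real.norm_eq_abs,
      sq_abs] at h2
    have h4 : t * (F p).toReal ≤ t * ((F y).toReal + 2 * k * inner ℝ (p - x) (y - p)
        + t * (k * ‖y - p‖ ^ 2)) := by nlinarith
    exact le_of_mul_le_mul_left h4 ht0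
  have hlim : Tendsto (fun t : ℝ => (F y).toReal + 2 * k * inner ℝ (p - x) (y - p)
        + t * (k * ‖y - p‖ ^ 2)) (𝓝[>] 0)
        (𝓝 ((F y).toReal + 2 * k * inner ℝ (p - x) (y - p) + 0 * (k * ‖y - p‖ ^ 2))) :=
    (Continuous.tendsto (by fun_prop) 0).mono_left nhdsWithin_le_nhds
  have hle := ge_of_tendsto hlim (by
    filter_upwards [Ioo_mem_nhdsGT (zero_lt_one' ℝ)] with t ht using key t ht.1 ht.2)
  rw [hi]
  linarith

/-- A point with subgradient `u` is the value of the proximity operator at the shift by `γ u`. -/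
theorem IsGammaZero.prox_add_smul_eq [CompleteSpace H] {F : H → EReal}
    (hF : IsGammaZero F) {γ : ℝ} (hγ : 0 < γ) {y u : H} (hu : u ∈ subdifferential F y) :
    prox γ F (y + γ • u) = y := by
  set p := prox γ F (y + γ • u) with hp
  -- Both subgradients arise from the same point `y + γ • u`, so their difference is a negative
  -- multiple of `y - p`.
  have h := hF.isMonotoneOp_subdifferential (y, u) hu
    (p, γ⁻¹ • (y + γ • u - p)) (hF.sub_prox_mem_subdifferential hγ _)
  have h1 : u - γ⁻¹ • (y + γ • u - p) = -(γ⁻¹ • (y - p)) := by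
    rw [add_sub_right_comm, smul_add, smul_smul, inv_mul_cancel₀ hγ.ne', one_smul]
    abel
  change 0 ≤ inner ℝ (y - p) (u - γ⁻¹ • (y + γ • u - p)) at h
  rw [h1, inner_neg_right, real_inner_smul_right, real_inner_self_eq_norm_sq] at h
  have h2 : 0 < γ⁻¹ := by positivity
  have h3 : ‖y - p‖ ^ 2 = 0 := le_antisymm (by nlinarith) (by positivity)
  exact (sub_eq_zero.1 (norm_eq_zero.1 (pow_eq_zero_iff two_ne_zero |>.1 h3))).symm

end ConvexAnalysis

/-! ### Convex functions with Lipschitz gradient -/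

section Gradient

variable {X : Type*} [NormedAddCommGroup X] [InnerProductSpace ℝ X] [CompleteSpace X]

/-- The derivative of a differentiable function along a line. -/
theorem hasDerivAt_comp_line {f : X → ℝ} (hf : Differentiable ℝ f) (x d : X) (t : ℝ) :
    HasDerivAt (fun t : ℝ => f (x + t • d)) (inner ℝ (gradient f (x + t • d)) d) t := by
  have h1 : HasDerivAt (fun t : ℝ => x + t • d) d t := by
    simpa using ((hasDerivAt_id t).smul_const d).const_add x
  rw [inner_gradient_left]
  exact (hf (x + t • d)).hasFDerivAt.comp_hasDerivAt t h1

/-- A convex function lies above its tangents. -/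
theorem add_inner_gradient_le {f : X → ℝ} (hc : ConvexOn ℝ Set.univ f)
    (hf : Differentiable ℝ f) (x y : X) :
    f x + inner ℝ (gradient f x) (y - x) ≤ f y := by
  have hd := hasDerivAt_comp_line hf x (y - x) 0
  have hlim := hd.tendsto_slope_zero_right
  simp only [zero_smul, add_zero, zero_add, smul_eq_mul] at hlim
  have hle : inner ℝ (gradient f x) (y - x) ≤ f y - f x := by
    refine le_of_tendsto hlim ?_
    filter_upwards [Ioo_mem_nhdsGT (zero_lt_one' ℝ)] with t ht
    have h1 := hc.2 (Set.mem_univ x) (Set.mem_univ y) (sub_nonneg.2 ht.2.le) ht.1.le (by ring)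
    have h2 : (1 - t) • x + t • y = x + t • (y - x) := by module
    rw [h2, smul_eq_mul, smul_eq_mul] at h1
    rw [inv_mul_le_iff₀ ht.1]
    linarith
  linarith

/-- The descent lemma. -/
theorem le_add_inner_gradient_add {f : X → ℝ} (hf : Differentiable ℝ f) {β : ℝ}
    (hL : ∀ x₁ x₂ : X, ‖gradient f x₁ - gradient f x₂‖ ≤ β * ‖x₁ - x₂‖) (x d : X) :
    f (x + d) ≤ f x + inner ℝ (gradient f x) d + β / 2 * ‖d‖ ^ 2 := by
  set φ : ℝ → ℝ := fun t =>
    f (x + t • d) - t * inner ℝ (gradient f x) d - β / 2 * ‖d‖ ^ 2 * t ^ 2 with hφ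
  have hd : ∀ t, HasDerivAt φ (inner ℝ (gradient f (x + t • d)) d - inner ℝ (gradient f x) d
      - β * ‖d‖ ^ 2 * t) t := by
    intro t
    have h1 := ((hasDerivAt_comp_line hf x d t).sub
      ((hasDerivAt_id t).mul_const (inner ℝ (gradient f x) d))).sub
      (((hasDerivAt_id t).pow 2).const_mul (β / 2 * ‖d‖ ^ 2))
    refine h1.congr_deriv ?_
    simp
    ring
  have hanti : AntitoneOn φ (Set.Icc 0 1) := by
    refine antitoneOn_of_deriv_nonpos (convex_Icc 0 1)
      (fun t _ => (hd t).continuousAt.continuousWithinAt)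
      (fun t _ => (hd t).differentiableAt.differentiableWithinAt) fun t ht => ?_
    rw [interior_Icc] at ht
    rw [(hd t).deriv, ← inner_sub_left]
    have h1 := real_inner_le_norm (gradient f (x + t • d) - gradient f x) d
    have h2 := hL (x + t • d) x
    rw [add_sub_cancel_left, norm_smul, Real.norm_of_nonneg ht.1.le] at h2
    nlinarith [norm_nonneg d]
  have h := hanti (Set.left_mem_Icc.2 zero_le_one) (Set.right_mem_Icc.2 zero_le_one) zero_le_one
  simp only [hφ, one_smul, zero_smul, add_zero] at h
  linarith

/-- The Baillon–Haddad theorem: the gradient of a convex function with `β`-Lipschitz gradient is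
`1 / β`-cocoercive. -/
theorem norm_sq_gradient_sub_le {f : X → ℝ} (hc : ConvexOn ℝ Set.univ f)
    (hf : Differentiable ℝ f) {β : ℝ} (hβ : 0 < β)
    (hL : ∀ x₁ x₂ : X, ‖gradient f x₁ - gradient f x₂‖ ≤ β * ‖x₁ - x₂‖) (x y : X) :
    ‖gradient f x - gradient f y‖ ^ 2 ≤ β * inner ℝ (gradient f x - gradient f y) (x - y) := by
  have key : ∀ x y : X, f x + inner ℝ (gradient f x) (y - x)
      + 1 / (2 * β) * ‖gradient f y - gradient f x‖ ^ 2 ≤ f y := by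
    intro x y
    set g := gradient f y - gradient f x with hg
    -- The gradient step `y - β⁻¹ • g` minimizes the quadratic upper model at `y` of `f - ⟨∇f x,
    -- ·⟩`; the tangent at `x` bounds `f` from below there.
    have h1 := le_add_inner_gradient_add hf hL y (-(β⁻¹ • g))
    have h2 := add_inner_gradient_le hc hf x (y + -(β⁻¹ • g))
    have h3 : y + -(β⁻¹ • g) - x = (y - x) - β⁻¹ • g := by abel
    rw [h3, inner_sub_right, real_inner_smul_right] at h2
    rw [inner_neg_right, real_inner_smul_right, norm_neg, norm_smul, mul_pow,
      Real.norm_eq_abs, sq_abs] at h1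
    have h4 : inner ℝ (gradient f y) g - inner ℝ (gradient f x) g = ‖g‖ ^ 2 := by
      rw [← inner_sub_left, ← hg, real_inner_self_eq_norm_sq]
    have h5 : β / 2 * (β⁻¹ ^ 2 * ‖g‖ ^ 2) = 1 / (2 * β) * ‖g‖ ^ 2 := by field_simp
    have h6 : β⁻¹ * inner ℝ (gradient f y) g - β⁻¹ * inner ℝ (gradient f x) g
        = 2 * (1 / (2 * β) * ‖g‖ ^ 2) := by
      rw [← mul_sub, h4]; field_simp
    linarith
  have h1 := key x y
  have h2 := key y x
  rw [norm_sub_rev] at h1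
  have h3 : inner ℝ (gradient f x - gradient f y) (x - y)
      = -(inner ℝ (gradient f x) (y - x) + inner ℝ (gradient f y) (x - y)) := by
    rw [inner_sub_left, ← neg_sub x y, inner_neg_right]; ring
  have h4 : 1 / β * ‖gradient f x - gradient f y‖ ^ 2
      ≤ inner ℝ (gradient f x - gradient f y) (x - y) := by
    have : 1 / β = 1 / (2 * β) + 1 / (2 * β) := by field_simp; norm_num
    rw [h3, this]; linarith
  rwa [one_div, inv_mul_le_iff₀ hβ] at h4

end Gradient

/-! ### Krasnosel'skiĭ–Mann iteration in a variable metric -/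

section KrasnoselskiiMann

variable {H : Type*} [NormedAddCommGroup H] [InnerProductSpace ℝ H]

/-- A bounded sequence in a Hilbert space has a weak limit along every ultrafilter. -/
theorem exists_weak_limit_ultrafilter [CompleteSpace H] {ι : Type*} (U : Ultrafilter ι) {z : ι → H} {M : ℝ}
    (hM : ∀ i, ‖z i‖ ≤ M) :
    ∃ w : H, ∀ v, Tendsto (fun i => inner ℝ (z i) v) U (𝓝 (inner ℝ w v)) := by
  have hbound : ∀ v i, |inner ℝ (z i) v| ≤ M * ‖v‖ := fun v i =>
    (abs_real_inner_le_norm _ _).trans (mul_le_mul_of_nonneg_right (hM i) (norm_nonneg v))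
  -- Compactness of an interval gives every pairing a limit along `U`; these limits form a bounded
  -- linear functional, represented by Riesz.
  have hlim : ∀ v, ∃ l, Tendsto (fun i => inner ℝ (z i) v) U (𝓝 l) := by
    intro v
    obtain ⟨l, -, hl⟩ := (isCompact_Icc (a := -(M * ‖v‖)) (b := M * ‖v‖)).ultrafilter_le_nhds
      (U.map fun i => inner ℝ (z i) v)
      (tendsto_principal.2 (Eventually.of_forall fun i => abs_le.1 (hbound v i)))
    exact ⟨l, hl⟩
  choose ℓ hℓ using hlim
  let φ : H →ₗ[ℝ] ℝ :=
    { toFun := ℓ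
      map_add' := fun v w => tendsto_nhds_unique (hℓ (v + w)) (by
        simpa only [inner_add_right] using (hℓ v).add (hℓ w))
      map_smul' := fun a v => tendsto_nhds_unique (hℓ (a • v)) (by
        simpa only [real_inner_smul_right, smul_eq_mul, RingHom.id_apply] using
          (hℓ v).const_mul a) }
  have hφ : ∀ v, ‖φ v‖ ≤ M * ‖v‖ := fun v =>
    le_of_tendsto (hℓ v).abs (Eventually.of_forall (hbound v))
  refine ⟨(InnerProductSpace.toDual ℝ H).symm (φ.mkContinuous M hφ), fun v => ?_⟩
  rw [InnerProductSpace.toDual_symm_apply]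
  exact hℓ v

/-- The pairing of a bounded weakly null family with a strongly convergent one tends to zero. -/
theorem tendsto_inner_zero_of_weak_of_strong {ι : Type*} {l : Filter ι} {z r : ι → H} {r₀ : H}
    {M : ℝ} (hM : ∀ i, ‖z i‖ ≤ M) (hz : ∀ v, Tendsto (fun i => inner ℝ (z i) v) l (𝓝 0))
    (hr : Tendsto r l (𝓝 r₀)) : Tendsto (fun i => inner ℝ (z i) (r i)) l (𝓝 0) := by
  have h1 : Tendsto (fun i => inner ℝ (z i) (r i - r₀)) l (𝓝 0) := by
    refine squeeze_zero_norm (fun i => ?_)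
      (by simpa using ((hr.sub_const r₀).norm.const_mul M) :
        Tendsto (fun i => M * ‖r i - r₀‖) l (𝓝 0))
    exact (abs_real_inner_le_norm _ _).trans
      (mul_le_mul_of_nonneg_right (hM i) (norm_nonneg _))
  have h2 := h1.add (hz r₀)
  simpa only [← inner_add_right, sub_add_cancel, add_zero] using h2

/-- The Krasnosel'skiĭ–Mann iteration for an operator `R` that is cocoercive in the metric of a
symmetric coercive operator `P`: the relaxed iteration `z - ρ R z` converges weakly to a zero
of `R`. -/
theorem exists_weak_limit_of_cocoercive [CompleteSpace H] (P : H →L[ℝ] H)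
    (hsymm : ∀ z w, inner ℝ (P z) w = inner ℝ (P w) z) {c : ℝ} (hc : 0 < c)
    (hcoer : ∀ z, c * ‖z‖ ^ 2 ≤ inner ℝ (P z) z) {R : H → H} {δ : ℝ} (hδ : 0 < δ)
    (hR : ∀ z w, δ * inner ℝ (P (R z - R w)) (R z - R w) ≤ 2 * inner ℝ (P (z - w)) (R z - R w))
    (hzero : ∃ w, R w = 0) {ρ : ℕ → ℝ} (hρ : ∀ n, ρ n ∈ Set.Ioo 0 δ)
    (hsum : Tendsto (fun N => ∑ n ∈ Finset.range N, ρ n * (δ - ρ n)) atTop atTop)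
    {z : ℕ → H} (hz : ∀ n, z (n + 1) = z n - ρ n • R (z n)) :
    ∃ w, R w = 0 ∧ ∀ v, Tendsto (fun n => inner ℝ (z n) v) atTop (𝓝 (inner ℝ w v)) := by
  have hpos : ∀ u, 0 ≤ inner ℝ (P u) u := fun u => le_trans (by positivity) (hcoer u)
  have hexp : ∀ (u v : H) (t : ℝ), inner ℝ (P (u - t • v)) (u - t • v)
      = inner ℝ (P u) u - 2 * t * inner ℝ (P u) v + t ^ 2 * inner ℝ (P v) v := by
    intro u v t
    simp only [map_sub, map_smul, inner_sub_left, inner_sub_right, real_inner_smul_left,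
      real_inner_smul_right, hsymm v u]
    ring
  have hfejer : ∀ w, R w = 0 → ∀ n, inner ℝ (P (z (n + 1) - w)) (z (n + 1) - w)
      + ρ n * (δ - ρ n) * inner ℝ (P (R (z n))) (R (z n))
      ≤ inner ℝ (P (z n - w)) (z n - w) := by
    intro w hw n
    have h1 := hR (z n) w
    rw [hw, sub_zero] at h1
    have h2 : z (n + 1) - w = (z n - w) - ρ n • R (z n) := by rw [hz]; abel
    rw [h2, hexp]
    nlinarith [mul_le_mul_of_nonneg_left h1 (hρ n).1.le]
  have hρδ : ∀ n, 0 ≤ ρ n * (δ - ρ n) := fun n =>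
    mul_nonneg (hρ n).1.le (sub_nonneg.2 (hρ n).2.le)
  have hanti : ∀ w, R w = 0 → Antitone fun n => inner ℝ (P (z n - w)) (z n - w) := by
    intro w hw
    refine antitone_nat_of_succ_le fun n => ?_
    have := hfejer w hw n
    have := mul_nonneg (hρδ n) (hpos (R (z n)))
    linarith
  have hRanti : Antitone fun n => inner ℝ (P (R (z n))) (R (z n)) := by
    refine antitone_nat_of_succ_le fun n => ?_
    set s := R (z n) - R (z (n + 1)) with hs
    have h1 := hR (z n) (z (n + 1))
    have h2 : z n - z (n + 1) = ρ n • R (z n) := by rw [hz]; abel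
    rw [← hs, h2, map_smul, real_inner_smul_left] at h1
    have h3 : R (z (n + 1)) = R (z n) - (1 : ℝ) • s := by rw [hs]; module
    rw [h3, hexp]
    have h4 := hpos s
    have h5 := hρ n
    -- Since `ρ n < δ`, cocoercivity between consecutive iterates still holds with `ρ n` for `δ`;
    -- cancelling `ρ n` shows that the residual decreases in the `P`-norm.
    have h6 : ρ n * inner ℝ (P s) s ≤ ρ n * (2 * inner ℝ (P (R (z n))) s) := by
      nlinarith [mul_le_mul_of_nonneg_right h5.2.le h4]
    have h7 := le_of_mul_le_mul_left h6 h5.1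
    linarith
  obtain ⟨w₀, hw₀⟩ := hzero
  set E := inner ℝ (P (z 0 - w₀)) (z 0 - w₀) with hE
  have hsumle : ∀ N, inner ℝ (P (z N - w₀)) (z N - w₀)
      + ∑ n ∈ Finset.range N, ρ n * (δ - ρ n) * inner ℝ (P (R (z n))) (R (z n)) ≤ E := by
    intro N
    induction N with
    | zero => simp [hE]
    | succ N ih =>
      rw [Finset.sum_range_succ]
      have := hfejer w₀ hw₀ N
      linarith
  -- As the residual norms decrease, the last one times the sum of the weights is at most `E`, and
  -- the weights have divergent sum.
  have hVlim : Tendsto (fun N => inner ℝ (P (R (z N))) (R (z N))) atTop (𝓝 0) := by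
    refine squeeze_zero' (Eventually.of_forall fun N => hpos _) ?_ (hsum.const_div_atTop E)
    filter_upwards [hsum.eventually_gt_atTop 0] with N hN
    rw [le_div_iff₀ hN, Finset.mul_sum]
    refine le_trans (Finset.sum_le_sum fun n hn => ?_)
      (le_of_add_le_of_nonneg_right (hsumle N) (hpos _))
    rw [mul_comm]
    exact mul_le_mul_of_nonneg_left (hRanti (Finset.mem_range.1 hn).le) (hρδ n)
  have hRlim : Tendsto (fun n => R (z n)) atTop (𝓝 0) := by
    have h1 : Tendsto (fun n => √(inner ℝ (P (R (z n))) (R (z n)) / c)) atTop (𝓝 0) := by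
      simpa using (hVlim.div_const c).sqrt
    refine squeeze_zero_norm (fun n => Real.le_sqrt_of_sq_le ?_) h1
    rw [le_div_iff₀ hc, mul_comm]
    exact hcoer _
  have hbd : ∀ w, R w = 0 → ∀ n, ‖z n - w‖ ≤ √(inner ℝ (P (z 0 - w)) (z 0 - w) / c) := by
    intro w hw n
    refine Real.le_sqrt_of_sq_le ?_
    rw [le_div_iff₀ hc, mul_comm]
    exact (hcoer _).trans (hanti w hw (Nat.zero_le n))
  have hzbd : ∀ n, ‖z n‖ ≤ √(E / c) + ‖w₀‖ := fun n => by
    have h1 := norm_le_norm_add_norm_sub' (z n) w₀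
    have h2 := hbd w₀ hw₀ n
    linarith
  have hcluster : ∀ U : Ultrafilter ℕ, (U : Filter ℕ) ≤ atTop → ∃ w, R w = 0 ∧
      ∀ v, Tendsto (fun n => inner ℝ (z n) v) U (𝓝 (inner ℝ w v)) := by
    intro U hU
    obtain ⟨w, hw⟩ := exists_weak_limit_ultrafilter U hzbd
    refine ⟨w, ?_, hw⟩
    have hr : Tendsto (fun n => R (z n) - R w) U (𝓝 (0 - R w)) :=
      (hRlim.mono_left hU).sub_const _
    have hweak : ∀ v, Tendsto (fun n => inner ℝ (z n - w) v) U (𝓝 0) := fun v => by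
      simpa [inner_sub_left] using (hw v).sub_const (inner ℝ w v)
    have hzwbd : ∀ n, ‖z n - w‖ ≤ √(E / c) + ‖w₀‖ + ‖w‖ := fun n =>
      (norm_sub_le _ _).trans (by linarith [hzbd n])
    have hPr : Tendsto (fun n => P (R (z n) - R w)) U (𝓝 (P (0 - R w))) :=
      (P.continuous.tendsto _).comp hr
    have h1 := (tendsto_inner_zero_of_weak_of_strong hzwbd hweak hPr).const_mul 2
    have h2 := (hPr.inner hr).const_mul δ
    -- Demiclosedness: in the cocoercivity inequality between `z n` and `w`, the right side pairs a
    -- weakly null family with a strongly convergent one, leaving `δ ⟨P (R w), R w⟩ ≤ 0`.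
    have h3 := le_of_tendsto_of_tendsto h2 h1 (Eventually.of_forall fun n => by
      have h := hR (z n) w
      rwa [hsymm (z n - w), real_inner_comm (z n - w)] at h)
    rw [mul_zero] at h3
    have h4 := hcoer (0 - R w)
    have h5 : inner ℝ (P (0 - R w)) (0 - R w) ≤ 0 := nonpos_of_mul_nonpos_right h3 hδ
    have h6 : ‖0 - R w‖ ^ 2 ≤ 0 := nonpos_of_mul_nonpos_right (h4.trans h5) hc
    rw [zero_sub, norm_neg] at h6
    exact norm_eq_zero.1 (pow_eq_zero_iff two_ne_zero |>.1 (le_antisymm h6 (by positivity)))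
  have hElim : ∀ w, R w = 0 → ∃ l, Tendsto (fun n => inner ℝ (P (z n - w)) (z n - w)) atTop
      (𝓝 l) := fun w hw =>
    ⟨_, tendsto_atTop_ciInf (hanti w hw) ⟨0, by rintro _ ⟨n, rfl⟩; exact hpos _⟩⟩
  have hunique : ∀ (U V : Ultrafilter ℕ) (w₁ w₂ : H), (U : Filter ℕ) ≤ atTop →
      (V : Filter ℕ) ≤ atTop → R w₁ = 0 → R w₂ = 0 →
      (∀ v, Tendsto (fun n => inner ℝ (z n) v) U (𝓝 (inner ℝ w₁ v))) →
      (∀ v, Tendsto (fun n => inner ℝ (z n) v) V (𝓝 (inner ℝ w₂ v))) → w₁ = w₂ := by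
    intro U V w₁ w₂ hU hV hw₁ hw₂ h₁ h₂
    obtain ⟨l₁, hl₁⟩ := hElim w₁ hw₁
    obtain ⟨l₂, hl₂⟩ := hElim w₂ hw₂
    -- Opial's argument: the difference of the squared `P`-distances to `w₁` and `w₂` is affine in
    -- this pairing, which therefore converges along the whole sequence, with the same limit for
    -- both ultrafilters.
    have hid : ∀ n, inner ℝ (z n) (P (w₁ - w₂))
        = (inner ℝ (P w₁) w₁ - inner ℝ (P w₂) w₂ - (inner ℝ (P (z n - w₁)) (z n - w₁)
          - inner ℝ (P (z n - w₂)) (z n - w₂))) / 2 := by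
      intro n
      rw [real_inner_comm, hsymm]
      simp only [map_sub, inner_sub_left, inner_sub_right, hsymm w₁ (z n), hsymm w₂ (z n)]
      ring
    have hlim := (((hl₁.sub hl₂).const_sub
      (inner ℝ (P w₁) w₁ - inner ℝ (P w₂) w₂)).div_const 2)
    simp_rw [← hid] at hlim
    have h3 := tendsto_nhds_unique (h₁ (P (w₁ - w₂))) (hlim.mono_left hU)
    have h4 := tendsto_nhds_unique (h₂ (P (w₁ - w₂))) (hlim.mono_left hV)
    have h5 : inner ℝ (P (w₁ - w₂)) (w₁ - w₂) = 0 := by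
      rw [real_inner_comm, inner_sub_left, h3, h4, sub_self]
    have h6 := hcoer (w₁ - w₂)
    rw [h5] at h6
    have h7 : ‖w₁ - w₂‖ ^ 2 ≤ 0 := nonpos_of_mul_nonpos_right h6 hc
    exact sub_eq_zero.1
      (norm_eq_zero.1 (pow_eq_zero_iff two_ne_zero |>.1 (le_antisymm h7 (by positivity))))
  obtain ⟨w, hw, hwlim⟩ := hcluster (Ultrafilter.of atTop) (Ultrafilter.of_le _)
  refine ⟨w, hw, fun v => ?_⟩
  rw [tendsto_iff_ultrafilter]
  intro U hU
  obtain ⟨w', hw', hw'lim⟩ := hcluster U hU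
  rw [hunique (Ultrafilter.of atTop) U w w' (Ultrafilter.of_le _) hU hw hw' hwlim hw'lim]
  exact hw'lim v

/-- Weak convergence in a Hilbert space can be tested on inner products. -/
theorem WeaklyConverges.of_inner [CompleteSpace H] {s : ℕ → H} {l : H}
    (h : ∀ v, Tendsto (fun n => inner ℝ (s n) v) atTop (𝓝 (inner ℝ l v))) :
    WeaklyConverges s l := by
  have hinj : Function.Injective (topDualPairing ℝ H).flip := fun a b hab =>
    (SeparatingDual.eq_iff_forall_dual_eq (R := ℝ)).2 fun φ => LinearMap.congr_fun hab φ
  refine (WeakBilin.tendsto_iff_forall_eval_tendsto _ hinj).2 fun φ => ?_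
  have h1 := h ((InnerProductSpace.toDual ℝ H).symm φ)
  simp_rw [real_inner_comm ((InnerProductSpace.toDual ℝ H).symm φ),
    InnerProductSpace.toDual_symm_apply] at h1
  exact h1

end KrasnoselskiiMann

/-! ### Firmly nonexpansive maps as resolvents -/

section Resolvent

variable {X : Type*} [NormedAddCommGroup X]

/-- The monotonicity form of firm nonexpansiveness. -/
theorem IsFirmlyNonexpansive.inner_nonneg [InnerProductSpace ℝ X] {J : X → X}
    (hJ : IsFirmlyNonexpansive J) (u v : X) :
    0 ≤ inner ℝ (J u - J v) ((u - J u) - (v - J v)) := by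
  have h := hJ u v
  -- With `a` the difference of the images and `b` that of the residuals, the hypothesis reads `‖a -
  -- b‖ ≤ ‖a + b‖`, that is `0 ≤ ⟨a, b⟩`.
  have h1 : (2 : ℝ) • J u - u - ((2 : ℝ) • J v - v)
      = (J u - J v) - ((u - J u) - (v - J v)) := by module
  have h2 : u - v = (J u - J v) + ((u - J u) - (v - J v)) := by abel
  have h3 := pow_le_pow_left₀ (norm_nonneg _) h 2
  simp only [h1] at h3
  rw [h2, norm_sub_sq_real, norm_add_sq_real] at h3
  linarith

/-- Membership in the graph of an operator with resolvent `J`. -/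
theorem IsResolventOf.mem_iff {J : X → X} {A : X → Set X} (h : IsResolventOf J A) (x u : X) :
    u ∈ A x ↔ J (u + x) = x := by
  have h1 : x ∈ ({J (u + x)} : Set X) ↔ x ∈ inverseOp (fun x => A x + {x}) (u + x) := by
    rw [← h]
  rw [Set.mem_singleton_iff] at h1
  rw [eq_comm, h1]
  simp [inverseOp]

/-- A firmly nonexpansive map is the resolvent of a maximally monotone operator. -/
theorem IsFirmlyNonexpansive.exists_isResolventOf [InnerProductSpace ℝ X] {J : X → X}
    (hJ : IsFirmlyNonexpansive J) :
    ∃ A : X → Set X, IsMaximallyMonotone A ∧ IsResolventOf J A := by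
  have hres : IsResolventOf J fun x => {u | J (u + x) = x} := by
    funext u
    ext x
    simp [inverseOp, eq_comm]
  refine ⟨fun x => {u | J (u + x) = x}, ⟨?_, ?_⟩, hres⟩
  · rintro ⟨x, u⟩ hu ⟨y, v⟩ hv
    have hu' : J (u + x) = x := hu
    have hv' : J (v + y) = y := hv
    have h := hJ.inner_nonneg (u + x) (v + y)
    rwa [hu', hv', add_sub_cancel_right, add_sub_cancel_right] at h
  · rintro ⟨B, hB, hsub, hne⟩
    refine hne fun p hp => ?_
    obtain ⟨x, u⟩ := p
    set q := J (u + x) with hq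
    -- Minty's argument: this point of the graph of `J⁻¹ - Id` has the same coordinate sum as `(x,
    -- u)`, so monotonicity of `B` forces the two to coincide.
    have hmem : (q, u + x - q) ∈ graph B := hsub (by
      change J (u + x - q + q) = q
      rw [sub_add_cancel])
    have h := hB _ hp _ hmem
    have h1 : u - (u + x - q) = -(x - q) := by abel
    change 0 ≤ inner ℝ (x - q) (u - (u + x - q)) at h
    rw [h1, inner_neg_right, real_inner_self_eq_norm_sq] at h
    have h2 : ‖x - q‖ ^ 2 = 0 := le_antisymm (by linarith) (by positivity)
    exact (sub_eq_zero.1 (norm_eq_zero.1 (pow_eq_zero_iff two_ne_zero |>.1 h2))).symm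

end Resolvent

/-! ### The primal-dual metric and the step residual -/

section PrimalDual

variable {X Y : Type*}
  [NormedAddCommGroup X] [InnerProductSpace ℝ X] [CompleteSpace X]
  [NormedAddCommGroup Y] [InnerProductSpace ℝ Y] [CompleteSpace Y]

/-- The metric operator `(x, y) ↦ (x / γ₁ - L* y, y / γ₂ - L x)` of the primal-dual splitting. -/
noncomputable def primalDualMetric (L : X →L[ℝ] Y) (γ₁ γ₂ : ℝ) :
    WithLp 2 (X × Y) →L[ℝ] WithLp 2 (X × Y) :=
  ((WithLp.prodContinuousLinearEquiv 2 ℝ X Y).symm : X × Y →L[ℝ] WithLp 2 (X × Y)) ∘L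
    ((γ₁⁻¹ • ContinuousLinearMap.fst ℝ X Y
        - ContinuousLinearMap.adjoint L ∘L ContinuousLinearMap.snd ℝ X Y).prod
      (γ₂⁻¹ • ContinuousLinearMap.snd ℝ X Y - L ∘L ContinuousLinearMap.fst ℝ X Y)) ∘L
    (WithLp.prodContinuousLinearEquiv 2 ℝ X Y : WithLp 2 (X × Y) →L[ℝ] X × Y)

/-- With the adjoint moved across, the cross terms are exchanged by swapping `z` and `w`, and the
bounds below become completed squares. -/
theorem inner_primalDualMetric (L : X →L[ℝ] Y) (γ₁ γ₂ : ℝ) (z w : WithLp 2 (X × Y)) :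
    inner ℝ (primalDualMetric L γ₁ γ₂ z) w
      = γ₁⁻¹ * inner ℝ z.fst w.fst - inner ℝ (L w.fst) z.snd
        + (γ₂⁻¹ * inner ℝ z.snd w.snd - inner ℝ (L z.fst) w.snd) := by
  have h1 : (primalDualMetric L γ₁ γ₂ z).fst
      = γ₁⁻¹ • z.fst - ContinuousLinearMap.adjoint L z.snd := rfl
  have h2 : (primalDualMetric L γ₁ γ₂ z).snd = γ₂⁻¹ • z.snd - L z.fst := rfl
  rw [WithLp.prod_inner_apply]
  change inner ℝ (primalDualMetric L γ₁ γ₂ z).fst w.fst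
    + inner ℝ (primalDualMetric L γ₁ γ₂ z).snd w.snd = _
  rw [h1, h2, inner_sub_left, inner_sub_left, real_inner_smul_left, real_inner_smul_left,
    ContinuousLinearMap.adjoint_inner_left, real_inner_comm (L w.fst)]

theorem primalDualMetric_symm (L : X →L[ℝ] Y) (γ₁ γ₂ : ℝ) (z w : WithLp 2 (X × Y)) :
    inner ℝ (primalDualMetric L γ₁ γ₂ z) w = inner ℝ (primalDualMetric L γ₁ γ₂ w) z := by
  rw [inner_primalDualMetric, inner_primalDualMetric, real_inner_comm w.fst,
    real_inner_comm w.snd]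
  ring

/-- Lower bound of the metric by the primal component. -/
theorem mul_norm_fst_sq_le_primalDualMetric (L : X →L[ℝ] Y) {γ₁ γ₂ : ℝ} (hγ₂ : 0 < γ₂)
    (z : WithLp 2 (X × Y)) :
    (1 / γ₁ - γ₂ * ‖L‖ ^ 2) * ‖z.fst‖ ^ 2 ≤ inner ℝ (primalDualMetric L γ₁ γ₂ z) z := by
  rw [inner_primalDualMetric, real_inner_self_eq_norm_sq, real_inner_self_eq_norm_sq]
  have h1 : inner ℝ (L z.fst) z.snd ≤ ‖L‖ * ‖z.fst‖ * ‖z.snd‖ :=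
    (real_inner_le_norm _ _).trans
      (mul_le_mul_of_nonneg_right (L.le_opNorm _) (norm_nonneg _))
  have h2 : 0 ≤ γ₂⁻¹ * (γ₂ * ‖L‖ * ‖z.fst‖ - ‖z.snd‖) ^ 2 := by positivity
  have h3 : γ₂⁻¹ * (γ₂ * ‖L‖ * ‖z.fst‖ - ‖z.snd‖) ^ 2 = γ₂ * ‖L‖ ^ 2 * ‖z.fst‖ ^ 2
      - 2 * (‖L‖ * ‖z.fst‖ * ‖z.snd‖) + γ₂⁻¹ * ‖z.snd‖ ^ 2 := by
    field_simp
    ring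
  rw [one_div, sub_mul]
  linarith

/-- Lower bound of the metric by the dual component. -/
theorem mul_norm_snd_sq_le_primalDualMetric (L : X →L[ℝ] Y) {γ₁ γ₂ : ℝ} (hγ₁ : 0 < γ₁)
    (hγ₂ : 0 < γ₂) (z : WithLp 2 (X × Y)) :
    (1 / γ₁ - γ₂ * ‖L‖ ^ 2) * (γ₁ / γ₂) * ‖z.snd‖ ^ 2
      ≤ inner ℝ (primalDualMetric L γ₁ γ₂ z) z := by
  rw [inner_primalDualMetric, real_inner_self_eq_norm_sq, real_inner_self_eq_norm_sq]
  have h1 : inner ℝ (L z.fst) z.snd ≤ ‖L‖ * ‖z.fst‖ * ‖z.snd‖ :=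
    (real_inner_le_norm _ _).trans
      (mul_le_mul_of_nonneg_right (L.le_opNorm _) (norm_nonneg _))
  have h2 : 0 ≤ γ₁⁻¹ * (‖z.fst‖ - γ₁ * ‖L‖ * ‖z.snd‖) ^ 2 := by positivity
  have h3 : γ₁⁻¹ * (‖z.fst‖ - γ₁ * ‖L‖ * ‖z.snd‖) ^ 2 = γ₁⁻¹ * ‖z.fst‖ ^ 2
      - 2 * (‖L‖ * ‖z.fst‖ * ‖z.snd‖) + γ₁ * ‖L‖ ^ 2 * ‖z.snd‖ ^ 2 := by
    field_simp
    ring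
  have h4 : (1 / γ₁ - γ₂ * ‖L‖ ^ 2) * (γ₁ / γ₂) * ‖z.snd‖ ^ 2
      = γ₂⁻¹ * ‖z.snd‖ ^ 2 - γ₁ * ‖L‖ ^ 2 * ‖z.snd‖ ^ 2 := by
    field_simp
  rw [h4]
  linarith

/-- The metric is coercive. -/
theorem primalDualMetric_coercive (L : X →L[ℝ] Y) {γ₁ γ₂ : ℝ} (hγ₁ : 0 < γ₁) (hγ₂ : 0 < γ₂)
    (hκ : 0 < 1 / γ₁ - γ₂ * ‖L‖ ^ 2) :
    ∃ c : ℝ, 0 < c ∧ ∀ z : WithLp 2 (X × Y),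
      c * ‖z‖ ^ 2 ≤ inner ℝ (primalDualMetric L γ₁ γ₂ z) z := by
  set κ := 1 / γ₁ - γ₂ * ‖L‖ ^ 2 with hκdef
  -- The average of the primal and dual lower bounds.
  refine ⟨min κ (κ * (γ₁ / γ₂)) / 2, by positivity, fun z => ?_⟩
  have h1 := mul_norm_fst_sq_le_primalDualMetric L (γ₁ := γ₁) hγ₂ z
  have h2 := mul_norm_snd_sq_le_primalDualMetric L hγ₁ hγ₂ z
  have h3 := mul_le_mul_of_nonneg_right (min_le_left κ (κ * (γ₁ / γ₂))) (sq_nonneg ‖z.fst‖)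
  have h4 := mul_le_mul_of_nonneg_right (min_le_right κ (κ * (γ₁ / γ₂))) (sq_nonneg ‖z.snd‖)
  have h5 : ‖z‖ ^ 2 = ‖z.fst‖ ^ 2 + ‖z.snd‖ ^ 2 := WithLp.prod_norm_sq_eq_of_L2 z
  rw [h5]
  linarith

/-- The primal component of the unrelaxed primal-dual step. -/
noncomputable def primalStep (J : X → X) (f : X → ℝ) (L : X →L[ℝ] Y) (γ₁ : ℝ) (x : X) (y : Y) :
    X :=
  J (x - γ₁ • (gradient f x + ContinuousLinearMap.adjoint L y))

/-- The dual component of the unrelaxed primal-dual step, from the new primal point `x'`. -/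
noncomputable def dualStep (h : Y → EReal) (L : X →L[ℝ] Y) (γ₂ : ℝ) (x x' : X) (y : Y) : Y :=
  prox γ₂ (conjugate h) (y + γ₂ • L ((2 : ℝ) • x' - x))

/-- The displacement `z - T z` of the unrelaxed primal-dual step `T`. -/
noncomputable def primalDualResidual (J : X → X) (f : X → ℝ) (h : Y → EReal) (L : X →L[ℝ] Y)
    (γ₁ γ₂ : ℝ) (z : WithLp 2 (X × Y)) : WithLp 2 (X × Y) :=
  WithLp.toLp 2 (z.fst - primalStep J f L γ₁ z.fst z.snd,
    z.snd - dualStep h L γ₂ z.fst (primalStep J f L γ₁ z.fst z.snd) z.snd)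

/-- The zeros of the residual are the solutions of the primal-dual inclusion. -/
theorem primalDualResidual_eq_zero_iff {J : X → X} {A : X → Set X} (hA : IsResolventOf J A)
    (f : X → ℝ) {h : Y → EReal} (hh : IsGammaZero h) (L : X →L[ℝ] Y) {γ₁ γ₂ : ℝ}
    (hγ₁ : 0 < γ₁) (hγ₂ : 0 < γ₂) (z : WithLp 2 (X × Y)) :
    primalDualResidual J f h L γ₁ γ₂ z = 0 ↔ (z.fst, z.snd) ∈ solutionSet A f h L γ₁ := by
  set x := z.fst with hx
  set y := z.snd with hy
  set g := gradient f x + ContinuousLinearMap.adjoint L y with hg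
  have hzero : primalDualResidual J f h L γ₁ γ₂ z = 0 ↔
      x - primalStep J f L γ₁ x y = 0 ∧
        y - dualStep h L γ₂ x (primalStep J f L γ₁ x y) y = 0 := by
    unfold primalDualResidual
    rw [WithLp.toLp_eq_zero, Prod.mk_eq_zero]
  have hprimal : (0 : X) ∈ γ₁⁻¹ • A x + {ContinuousLinearMap.adjoint L y} + {gradient f x} ↔
      primalStep J f L γ₁ x y = x := by
    have h1 : primalStep J f L γ₁ x y = J (-(γ₁ • g) + x) := by
      rw [neg_add_eq_sub]; rfl
    rw [h1, ← hA.mem_iff, Set.add_singleton, Set.add_singleton, Set.mem_image]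
    simp only [Set.mem_image, exists_exists_and_eq_and]
    constructor
    · rintro ⟨u, hu, hu0⟩
      obtain ⟨v, hv, rfl⟩ := hu
      have h2 : γ₁ • (γ₁⁻¹ • v + ContinuousLinearMap.adjoint L y + gradient f x) = γ₁ • 0 :=
        congrArg _ hu0
      have h3 : v = -(γ₁ • g) := by
        rw [add_assoc, smul_add, smul_smul, mul_inv_cancel₀ hγ₁.ne', one_smul, smul_zero,
          add_comm (ContinuousLinearMap.adjoint L y)] at h2
        exact eq_neg_of_add_eq_zero_left h2
      rwa [← h3]
    · intro hm
      refine ⟨_, Set.smul_mem_smul_set hm, ?_⟩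
      rw [smul_neg, smul_smul, inv_mul_cancel₀ hγ₁.ne', one_smul, hg]
      abel
  have hdual : (0 : Y) ∈ {-(L x)} + subdifferential (conjugate h) y ↔
      prox γ₂ (conjugate h) (y + γ₂ • L x) = y := by
    rw [Set.singleton_add, Set.mem_image]
    constructor
    · rintro ⟨u, hu, hu0⟩
      have h1 : u = L x := (neg_add_eq_zero.1 hu0).symm
      exact hh.conjugate.prox_add_smul_eq hγ₂ (h1 ▸ hu)
    · intro hp
      have h1 := hh.conjugate.sub_prox_mem_subdifferential hγ₂ (y + γ₂ • L x)
      rw [hp, add_sub_cancel_left, smul_smul, inv_mul_cancel₀ hγ₂.ne', one_smul] at h1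
      exact ⟨_, h1, neg_add_cancel _⟩
  change _ ↔ _ ∧ _
  rw [hzero, hprimal, hdual, sub_eq_zero, sub_eq_zero]
  -- When the primal component is fixed, the extrapolated point `2 x' - x` is `x` itself.
  constructor
  · rintro ⟨h1, h2⟩
    rw [← h1, dualStep, two_smul, add_sub_cancel_right] at h2
    exact ⟨h1.symm, h2.symm⟩
  · rintro ⟨h1, h2⟩
    refine ⟨h1.symm, ?_⟩
    rw [h1, dualStep, two_smul, add_sub_cancel_right, h2]

/-- The residual of the primal-dual step is cocoercive in the metric `primalDualMetric`. -/
theorem primalDualResidual_cocoercive {J : X → X} (hJ : IsFirmlyNonexpansive J)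
    {f : X → ℝ} (hfc : ConvexOn ℝ Set.univ f) (hfd : Differentiable ℝ f) {β : ℝ} (hβ : 0 < β)
    (hfl : ∀ x₁ x₂ : X, ‖gradient f x₁ - gradient f x₂‖ ≤ β * ‖x₁ - x₂‖)
    {h : Y → EReal} (hh : IsGammaZero h) (L : X →L[ℝ] Y) {γ₁ γ₂ : ℝ}
    (hγ₁ : 0 < γ₁) (hγ₂ : 0 < γ₂) (hκ : 0 < 1 / γ₁ - γ₂ * ‖L‖ ^ 2)
    (z w : WithLp 2 (X × Y)) :
    (2 - β / 2 * (1 / γ₁ - γ₂ * ‖L‖ ^ 2)⁻¹) *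
        inner ℝ (primalDualMetric L γ₁ γ₂
          (primalDualResidual J f h L γ₁ γ₂ z - primalDualResidual J f h L γ₁ γ₂ w))
          (primalDualResidual J f h L γ₁ γ₂ z - primalDualResidual J f h L γ₁ γ₂ w)
      ≤ 2 * inner ℝ (primalDualMetric L γ₁ γ₂ (z - w))
          (primalDualResidual J f h L γ₁ γ₂ z - primalDualResidual J f h L γ₁ γ₂ w) := by
  set κ := 1 / γ₁ - γ₂ * ‖L‖ ^ 2 with hκdef
  set s := primalDualResidual J f h L γ₁ γ₂ z - primalDualResidual J f h L γ₁ γ₂ w with hs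
  set d := z - w with hd
  set c := gradient f z.fst - gradient f w.fst with hc
  set xz := primalStep J f L γ₁ z.fst z.snd with hxz
  set xw := primalStep J f L γ₁ w.fst w.snd with hxw
  set yz := dualStep h L γ₂ z.fst xz z.snd with hyz
  set yw := dualStep h L γ₂ w.fst xw w.snd with hyw
  have hd1 : d.fst = z.fst - w.fst := rfl
  have hd2 : d.snd = z.snd - w.snd := rfl
  have hs1 : s.fst = (z.fst - xz) - (w.fst - xw) := rfl
  have hs2 : s.snd = (z.snd - yz) - (w.snd - yw) := rfl
  have he1 : xz - xw = d.fst - s.fst := by rw [hd1, hs1]; abel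
  have he2 : yz - yw = d.snd - s.snd := by rw [hd2, hs2]; abel
  have hJmono : 0 ≤ inner ℝ (d.fst - s.fst)
      (s.fst - γ₁ • (c + ContinuousLinearMap.adjoint L d.snd)) := by
    have h1 := hJ.inner_nonneg
      (z.fst - γ₁ • (gradient f z.fst + ContinuousLinearMap.adjoint L z.snd))
      (w.fst - γ₁ • (gradient f w.fst + ContinuousLinearMap.adjoint L w.snd))
    change 0 ≤ inner ℝ (xz - xw)
      ((z.fst - γ₁ • (gradient f z.fst + ContinuousLinearMap.adjoint L z.snd) - xz)
        - (w.fst - γ₁ • (gradient f w.fst + ContinuousLinearMap.adjoint L w.snd) - xw)) at h1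
    rw [he1] at h1
    convert h1 using 2
    rw [hs1, hc, hd2, map_sub]
    module
  have hpmono : 0 ≤ inner ℝ (d.snd - s.snd)
      (γ₂⁻¹ • s.snd + L (d.fst - (2 : ℝ) • s.fst)) := by
    have h1 := hh.conjugate.isMonotoneOp_subdifferential
      (yz, _) (hh.conjugate.sub_prox_mem_subdifferential hγ₂ _)
      (yw, _) (hh.conjugate.sub_prox_mem_subdifferential hγ₂ _)
    change 0 ≤ inner ℝ (yz - yw)
      (γ₂⁻¹ • (z.snd + γ₂ • L ((2 : ℝ) • xz - z.fst) - yz)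
        - γ₂⁻¹ • (w.snd + γ₂ • L ((2 : ℝ) • xw - w.fst) - yw)) at h1
    rw [he2] at h1
    have h2 : d.fst - (2 : ℝ) • s.fst
        = ((2 : ℝ) • xz - z.fst) - ((2 : ℝ) • xw - w.fst) := by rw [hd1, hs1]; module
    have h3 : ∀ u : Y, u = γ₂⁻¹ • γ₂ • u := fun u => by
      rw [smul_smul, inv_mul_cancel₀ hγ₂.ne', one_smul]
    convert h1 using 2
    rw [h2, hs2, h3 (L _), map_sub]
    module
  have hcoco := norm_sq_gradient_sub_le hfc hfd hβ hfl z.fst w.fst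
  rw [← hc, ← hd1] at hcoco
  have hPs := mul_norm_fst_sq_le_primalDualMetric L (γ₁ := γ₁) hγ₂ s
  rw [← hκdef] at hPs
  have hcs := (real_inner_le_norm c s.fst)
  -- In the sum of the two monotonicity inequalities, the extrapolation cancels the `⟨L d.fst,
  -- d.snd⟩` terms and leaves the cross terms of `P`.
  have hmono : inner ℝ (primalDualMetric L γ₁ γ₂ s) s + inner ℝ c d.fst - inner ℝ c s.fst
      ≤ inner ℝ (primalDualMetric L γ₁ γ₂ d) s := by
    have h1 := mul_nonneg (inv_nonneg.2 hγ₁.le) hJmono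
    rw [inner_sub_right, real_inner_smul_right, mul_sub, ← mul_assoc γ₁⁻¹ γ₁,
      inv_mul_cancel₀ hγ₁.ne', one_mul, inner_add_right,
      ContinuousLinearMap.adjoint_inner_right, map_sub] at h1
    rw [map_sub, map_smul] at hpmono
    rw [inner_primalDualMetric, inner_primalDualMetric]
    simp only [inner_sub_left, inner_sub_right, inner_add_right, real_inner_smul_right,
      real_inner_comm d.fst c, real_inner_comm s.fst c, real_inner_comm d.snd (L d.fst),
      real_inner_comm d.snd (L s.fst), real_inner_comm s.snd (L d.fst),
      real_inner_comm s.snd (L s.fst)] at h1 hpmono ⊢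
    linarith
  -- Young's inequality, weighted so that cocoercivity of the gradient absorbs the whole `‖c‖²`
  -- term.
  have h1 : 2 * inner ℝ c s.fst ≤ 2 * inner ℝ c d.fst + β / 2 * ‖s.fst‖ ^ 2 := by
    have h2 : 2 * (‖c‖ * ‖s.fst‖) ≤ 2 / β * ‖c‖ ^ 2 + β / 2 * ‖s.fst‖ ^ 2 := by
      have h3 : 0 ≤ 2 / β * (‖c‖ - β / 2 * ‖s.fst‖) ^ 2 := by positivity
      have h4 : 2 / β * (‖c‖ - β / 2 * ‖s.fst‖) ^ 2
          = 2 / β * ‖c‖ ^ 2 - 2 * (‖c‖ * ‖s.fst‖) + β / 2 * ‖s.fst‖ ^ 2 := by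
        field_simp
        ring
      linarith
    have h5 : 2 / β * ‖c‖ ^ 2 ≤ 2 * inner ℝ c d.fst := by
      rw [div_mul_eq_mul_div, div_le_iff₀ hβ]
      linarith
    linarith
  -- This loss, charged to the metric, is what lowers the constant from `2` to `δ`.
  have h2 : β / 2 * ‖s.fst‖ ^ 2 ≤ β / 2 * κ⁻¹ * inner ℝ (primalDualMetric L γ₁ γ₂ s) s := by
    rw [mul_assoc]
    refine mul_le_mul_of_nonneg_left ?_ (by positivity)
    rw [inv_mul_eq_div, le_div_iff₀ hκ, mul_comm]
    exact hPs
  linarith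

end PrimalDual

end PnPPDS

/-! ### Weak convergence of the algorithm -/

theorem proposition3p1
    {X Y : Type*}
    [NormedAddCommGroup X] [InnerProductSpace ℝ X] [CompleteSpace X]
    [NormedAddCommGroup Y] [InnerProductSpace ℝ Y] [CompleteSpace Y]
    (f : X → ℝ) (hf_convex : ConvexOn ℝ Set.univ f) (hf_diff : Differentiable ℝ f)
    (β : ℝ) (hβ : 0 < β)
    (hf_lip : ∀ x₁ x₂ : X, ‖gradient f x₁ - gradient f x₂‖ ≤ β * ‖x₁ - x₂‖)
    (h : Y → EReal) (hh : PnPPDS.IsGammaZero h)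
    (L : X →L[ℝ] Y)
    (J : X → X) (hJ : PnPPDS.IsFirmlyNonexpansive J)
    (γ₁ γ₂ : ℝ) (hγ₁ : 0 < γ₁) (hγ₂ : 0 < γ₂)
    (δ : ℝ) (hδ : δ = 2 - β / 2 * (1 / γ₁ - γ₂ * ‖L‖ ^ 2)⁻¹)
    (ρ : ℕ → ℝ) :
    (∃ A : X → Set X, PnPPDS.IsMaximallyMonotone A ∧ PnPPDS.IsResolventOf J A) ∧
    ∀ A : X → Set X, PnPPDS.IsMaximallyMonotone A → PnPPDS.IsResolventOf J A →
      (PnPPDS.solutionSet A f h L γ₁).Nonempty →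
      1 / γ₁ - γ₂ * ‖L‖ ^ 2 > β / 2 →
      (∀ n, ρ n ∈ Set.Ioo 0 δ) →
      Tendsto (fun N => ∑ n ∈ Finset.range N, ρ n * (δ - ρ n)) atTop atTop →
      ∀ (x : ℕ → X) (y : ℕ → Y), PnPPDS.IsIteration J f h L γ₁ γ₂ ρ x y →
        ∃ z ∈ PnPPDS.solutionSet A f h L γ₁,
          PnPPDS.WeaklyConverges (H := WithLp 2 (X × Y))
            (fun n => WithLp.toLp 2 (x n, y n)) (WithLp.toLp 2 z) := by
  refine ⟨hJ.exists_isResolventOf, fun A _ hA hsol hκβ hρ hsum x y hiter => ?_⟩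
  have hκ : 0 < 1 / γ₁ - γ₂ * ‖L‖ ^ 2 := by linarith
  obtain ⟨c, hc, hcoer⟩ := PnPPDS.primalDualMetric_coercive L hγ₁ hγ₂ hκ
  obtain ⟨z₀, hz₀⟩ := hsol
  obtain ⟨xt, yt, hit⟩ := hiter
  have hstep : ∀ n, WithLp.toLp 2 (x (n + 1), y (n + 1))
      = WithLp.toLp 2 (x n, y n)
        - ρ n • PnPPDS.primalDualResidual J f h L γ₁ γ₂ (WithLp.toLp 2 (x n, y n)) := by
    intro n
    obtain ⟨h1, h2, h3, h4⟩ := hit n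
    have h5 : PnPPDS.primalDualResidual J f h L γ₁ γ₂ (WithLp.toLp 2 (x n, y n))
        = WithLp.toLp 2 (x n - xt (n + 1), y n - yt (n + 1)) := by
      rw [h2, h1]; rfl
    rw [h5, ← WithLp.toLp_smul, ← WithLp.toLp_sub, h3, h4]
    congr 1
    ext <;> simp only [Prod.smul_mk, Prod.mk_sub_mk] <;> module
  obtain ⟨w, hw, hlim⟩ := PnPPDS.exists_weak_limit_of_cocoercive
    (PnPPDS.primalDualMetric L γ₁ γ₂) (PnPPDS.primalDualMetric_symm L γ₁ γ₂) hc hcoer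
    -- Positivity of `δ` follows from the interval `(0, δ)` containing `ρ 0`.
    (R := PnPPDS.primalDualResidual J f h L γ₁ γ₂) ((hρ 0).1.trans (hρ 0).2)
    (fun z w => hδ ▸ PnPPDS.primalDualResidual_cocoercive hJ hf_convex hf_diff hβ hf_lip hh L
      hγ₁ hγ₂ hκ z w)
    ⟨WithLp.toLp 2 z₀, (PnPPDS.primalDualResidual_eq_zero_iff hA f hh L hγ₁ hγ₂ _).2 hz₀⟩
    hρ hsum (z := fun n => WithLp.toLp 2 (x n, y n)) hstep
  exact ⟨(w.fst, w.snd), (PnPPDS.primalDualResidual_eq_zero_iff hA f hh L hγ₁ hγ₂ w).1 hw,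
    PnPPDS.WeaklyConverges.of_inner hlim⟩
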